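/- Let $q$ be a prime power and let $n,m$ be integers with $2\le n\le m$. The rank $\mathrm{rk}(v)$ of a vector $v\in\mathbb{F}_{q^m}^n$ is the dimension over $\mathbb{F}_q$ of the $\mathbb{F}_q$-span of its entries. Let $\mathscr{L}=\mathscr{L}_{n-1}(n,m;q)$ be the set of all $\mathbb{F}_{q^m}$-subspaces of $\mathbb{F}_{q^m}^n$ of the form $\langle v_1,\dots,v_\ell\rangle_{\mathbb{F}_{q^m}}$ with $\ell\ge 1$ and $\mathrm{rk}(v_k)\le n-1$ for all $k$, ordered by inclusion; it is a finite graded lattice with minimum $0$, whose rank function $\rho$ is the $\mathbb{F}_{q^m}$-dimension. Let $\mu$ be its Möbius function, let $$w_j=\sum_{X\in\mathscr{L},\ \rho(X)=j}\mu(0,X),\qquad W_j=|\{X\in\mathscr{L}:\rho(X)=j\}|$$ be its Whitney numbers of the first and of the second kind, and for integers $0\le b\le a$ and $Q\ge 2$ let $\binom{a}{b}_{Q}=\prod_{i=0}^{b-1}\frac{Q^{a-i}-1}{Q^{i+1}-1}$. Then: 1. $w_0=1$. 2. For all $j\in\{1,\dots,n\}$, $$w_j=(-1)^j\left(q^{m\binom{j}{2}}\binom{n}{j}_{q^m}-q^{m\binom{j-1}{2}}\binom{n-1}{j-1}_{q^m}\prod_{s=1}^{n-1}(q^m-q^s)\right).$$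 3. $W_0=1$. 4. $W_1=\binom{n}{1}_{q^m}-\prod_{s=1}^{n-1}(q^m-q^s)$. 5. $W_j=\binom{n}{j}_{q^m}$ for all $j\in\{2,\dots,n\}$. -/

import Mathlib

/-- The rank (weight) of a vector `v ∈ Lⁿ` over the subfield `K`: the `K`-dimension of the
`K`-span of its entries. -/
noncomputable def vectorRank (K : Type*) {L : Type*} [Field K] [Field L] [Algebra K L] {n : ℕ}
    (v : Fin n → L) : ℕ :=
  Module.finrank K (Submodule.span K (Set.range v))

/-- The rank-metric lattice `𝓛_i(n,m;q)`, where `K = 𝔽_q` and `L = 𝔽_{q^m}`: the `L`-subspaces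
of `Lⁿ` of the form `⟨v₁, …, v_ℓ⟩` with `ℓ ≥ 1` and every `v_k` of rank at most `i`. -/
def RankMetricLattice (K L : Type*) [Field K] [Field L] [Algebra K L] (i n : ℕ) : Type _ :=
  {X : Submodule L (Fin n → L) //
    ∃ ℓ : ℕ, 1 ≤ ℓ ∧ ∃ v : Fin ℓ → Fin n → L,
      (∀ k, vectorRank K (v k) ≤ i) ∧ X = Submodule.span L (Set.range v)}

namespace RankMetricLattice

variable {K L : Type*} [Field K] [Field L] [Algebra K L] {i n : ℕ}

/-- The order is inclusion of subspaces. -/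
instance : PartialOrder (RankMetricLattice K L i n) :=
  Subtype.partialOrder _

noncomputable instance : OrderBot (RankMetricLattice K L i n) where
  bot := ⟨⊥, 1, le_rfl, fun _ => 0, fun _ => by
    have h : Submodule.span K (Set.range (0 : Fin n → L)) = ⊥ := by
      rw [Submodule.span_eq_bot]
      rintro _ ⟨_, rfl⟩
      rfl
    rw [vectorRank, h, finrank_bot]
    exact Nat.zero_le i, by simp⟩
  bot_le X := (bot_le : (⊥ : Submodule L (Fin n → L)) ≤ X.1)

/-- The poset is graded, with rank function the `L`-dimension. -/
noncomputable instance : GradeMinOrder ℕ (RankMetricLattice K L i n) where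
  grade X := Module.finrank L X.1
  grade_strictMono _ _ h := Submodule.finrank_lt_finrank_of_lt h
  covBy_grade := by
    rintro X Y hXY
    have hlt : X.1 < Y.1 := hXY.1
    obtain ⟨ℓ, hℓ, v, hv, hY⟩ := Y.2
    obtain ⟨k, hk⟩ : ∃ k, v k ∉ X.1 := by
      by_contra! h
      refine hlt.not_ge ?_
      rw [hY, Submodule.span_le]
      rintro _ ⟨k, rfl⟩
      exact h k
    obtain ⟨ℓ', hℓ', u, hu, hX⟩ := X.2
    let Z : RankMetricLattice K L i n :=
      ⟨Submodule.span L {v k} ⊔ X.1, ℓ' + 1, by omega, Fin.cons (v k) u,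
        fun j => by
          refine Fin.cases ?_ (fun j => ?_) j
          · simpa using hv k
          · simpa using hu j,
        by rw [Fin.range_cons, Submodule.span_insert, ← hX]⟩
    have hZ : X < Z := by
      refine lt_of_le_of_ne (le_sup_right : X.1 ≤ Submodule.span L {v k} ⊔ X.1) fun h => hk ?_
      have h' : X.1 = Submodule.span L {v k} ⊔ X.1 := congrArg Subtype.val h
      rw [h']
      exact Submodule.mem_sup_left (Submodule.mem_span_singleton_self _)
    have hvY : Submodule.span L {v k} ≤ Y.1 := by
      rw [hY]
      exact Submodule.span_mono (by rintro _ rfl; exact ⟨k, rfl⟩)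
    have hZY : Z = Y := by
      by_contra hne
      exact hXY.2 hZ (lt_of_le_of_ne (sup_le hvY hlt.le : Z.1 ≤ Y.1) hne)
    have hdim : Module.finrank L Y.1 ≤ Module.finrank L X.1 + 1 := by
      rw [← hZY]
      have h1 := Submodule.finrank_add_le_finrank_add_finrank (Submodule.span L {v k}) X.1
      have h2 := finrank_span_le_card (R := L) ({v k} : Set (Fin n → L))
      simp only [Set.toFinset_singleton, Finset.card_singleton] at h2
      change Module.finrank L ↥(Submodule.span L {v k} ⊔ X.1) ≤ _
      omega
    have := Submodule.finrank_lt_finrank_of_lt hlt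
    rw [Nat.covBy_iff_add_one_eq]
    omega
  isMin_grade := by
    intro X hX
    have h : X = ⊥ := le_antisymm (hX bot_le) bot_le
    subst h
    have : Module.finrank L (⊥ : Submodule L (Fin n → L)) = 0 := finrank_bot L _
    exact fun b _ => this.trans_le (Nat.zero_le b)

noncomputable instance [Finite L] : Fintype (RankMetricLattice K L i n) :=
  haveI : Finite (RankMetricLattice K L i n) := Subtype.finite
  Fintype.ofFinite _

open Classical in
noncomputable instance [Finite L] : LocallyFiniteOrder (RankMetricLattice K L i n) :=
  Fintype.toLocallyFiniteOrder

end RankMetricLattice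

open Classical in
/-- The `j`-th Whitney number of the first kind of a finite graded poset with minimum:
the sum of `μ(0, s)` over the elements `s` of rank `j`. -/
noncomputable def whitneyFirst (P : Type*) [PartialOrder P] [OrderBot P] [Fintype P]
    [LocallyFiniteOrder P] [GradeMinOrder ℕ P] (j : ℕ) : ℤ :=
  ∑ s : P with grade ℕ s = j, IncidenceAlgebra.mu ℤ (⊥ : P) s

/-- The `j`-th Whitney number of the second kind of a finite graded poset with minimum:
the number of elements of rank `j`. -/
noncomputable def whitneySecond (P : Type*) [PartialOrder P] [OrderBot P] [Fintype P]
    [GradeMinOrder ℕ P] (j : ℕ) : ℕ :=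
  Nat.card {s : P // grade ℕ s = j}

/-- The `Q`-binomial coefficient of natural numbers `a` and `b`. -/
def gaussianBinomial (Q a b : ℕ) : ℚ :=
  if a < b then 0 else ∏ i ∈ Finset.range b, ((Q : ℚ) ^ (a - i) - 1) / ((Q : ℚ) ^ (i + 1) - 1)

/-!
Deleting an antichain `A` from a poset changes its Möbius function in a controlled way: as no
chain meets `A` twice, `μ(a, b)` becomes `μ(a, b) - ∑ x ∈ A, μ(a, x) μ(x, b)`. A subspace of `Lⁿ`
fails to be spanned by its vectors of rank less than `n` exactly when it is a line spanned by a
vector of rank `n`, so `𝓛_{n-1}` is the lattice of all subspaces of `Lⁿ` with the antichain of these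
lines deleted. In the full subspace lattice `μ(A, B) = (-1)^k Q^(k choose 2)`, where `Q = |L|` and
`k = dim B - dim A`, by the vanishing of alternating sums of Gaussian binomials. Finally the deleted
lines are counted by dividing the number of `K`-linearly independent `n`-tuples in `L` by `Q - 1`.
-/

open Module IncidenceAlgebra

section GaussianBinomial

variable {Q : ℕ}

theorem gaussianBinomial_zero_right (Q a : ℕ) : gaussianBinomial Q a 0 = 1 := by
  simp [gaussianBinomial]

theorem gaussianBinomial_eq_zero_of_lt {a b : ℕ} (h : a < b) : gaussianBinomial Q a b = 0 :=
  if_pos h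

theorem natCast_pow_sub_one_ne_zero (hQ : 1 < Q) {k : ℕ} (hk : k ≠ 0) : (Q : ℚ) ^ k - 1 ≠ 0 :=
  sub_ne_zero.2 (one_lt_pow₀ (by exact_mod_cast hQ) hk).ne'

theorem gaussianBinomial_succ_right (Q a b : ℕ) :
    gaussianBinomial Q a (b + 1) =
      gaussianBinomial Q a b * (((Q : ℚ) ^ (a - b) - 1) / ((Q : ℚ) ^ (b + 1) - 1)) := by
  rcases lt_trichotomy a b with h | rfl | h
  · rw [gaussianBinomial_eq_zero_of_lt h, gaussianBinomial_eq_zero_of_lt (by lia), zero_mul]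
  · simp [gaussianBinomial]
  · rw [gaussianBinomial, if_neg (by lia), gaussianBinomial, if_neg h.not_gt,
      Finset.prod_range_succ]

theorem gaussianBinomial_succ_succ (Q a b : ℕ) :
    gaussianBinomial Q (a + 1) (b + 1) =
      gaussianBinomial Q a b * (((Q : ℚ) ^ (a + 1) - 1) / ((Q : ℚ) ^ (b + 1) - 1)) := by
  rcases lt_or_ge a b with h | h
  · rw [gaussianBinomial_eq_zero_of_lt h, gaussianBinomial_eq_zero_of_lt (by lia), zero_mul]
  · rw [gaussianBinomial, if_neg (by lia), gaussianBinomial, if_neg h.not_gt,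
      Finset.prod_div_distrib, Finset.prod_div_distrib, Finset.prod_range_succ',
      Finset.prod_range_succ, div_mul_div_comm]
    simp only [Nat.add_sub_add_right, Nat.sub_zero]

theorem gaussianBinomial_pascal (hQ : 1 < Q) (a b : ℕ) :
    gaussianBinomial Q (a + 1) (b + 1) =
      gaussianBinomial Q a b + (Q : ℚ) ^ (b + 1) * gaussianBinomial Q a (b + 1) := by
  rcases lt_or_ge a b with h | h
  · rw [gaussianBinomial_eq_zero_of_lt h, gaussianBinomial_eq_zero_of_lt (by lia),
      gaussianBinomial_eq_zero_of_lt (by lia), mul_zero, add_zero]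
  · have hden := natCast_pow_sub_one_ne_zero hQ b.add_one_ne_zero
    have hpow : (Q : ℚ) ^ (a + 1) = (Q : ℚ) ^ (b + 1) * (Q : ℚ) ^ (a - b) := by
      rw [← pow_add]
      congr 1
      lia
    rw [gaussianBinomial_succ_succ, gaussianBinomial_succ_right, hpow]
    field_simp
    ring

theorem sum_range_succ_neg_one_pow_mul_gaussianBinomial (hQ : 1 < Q) (a k : ℕ) :
    ∑ i ∈ Finset.range (k + 1), (-1) ^ i * (Q : ℚ) ^ i.choose 2 * gaussianBinomial Q (a + 1) i =
      (-1) ^ k * (Q : ℚ) ^ (k + 1).choose 2 * gaussianBinomial Q a k := by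
  induction k with
  | zero => simp [gaussianBinomial_zero_right]
  | succ k ih =>
    rw [Finset.sum_range_succ, ih, gaussianBinomial_pascal hQ, Nat.choose_succ_succ' (k + 1) 1,
      Nat.choose_one_right, pow_add, pow_succ (-1 : ℚ)]
    ring

theorem sum_neg_one_pow_mul_gaussianBinomial (hQ : 1 < Q) (a : ℕ) :
    ∑ i ∈ Finset.range (a + 1), (-1) ^ i * (Q : ℚ) ^ i.choose 2 * gaussianBinomial Q a i =
      if a = 0 then 1 else 0 := by
  cases a with
  | zero => simp [gaussianBinomial_zero_right]
  | succ a =>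
    rw [sum_range_succ_neg_one_pow_mul_gaussianBinomial hQ,
      gaussianBinomial_eq_zero_of_lt a.lt_succ_self, mul_zero, if_neg a.succ_ne_zero]

theorem prod_range_succ_pow_sub_pow {R : Type*} [CommRing R] (x : R) (a b : ℕ) :
    ∏ i ∈ Finset.range (b + 1), (x ^ (a + 1) - x ^ i) =
      (x ^ (a + 1) - 1) * (x ^ b * ∏ i ∈ Finset.range b, (x ^ a - x ^ i)) := by
  rw [Finset.prod_range_succ', pow_zero, mul_comm, ← Finset.card_range b,
    ← Finset.prod_const, Finset.card_range, ← Finset.prod_mul_distrib]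
  simp only [pow_succ', mul_sub]

theorem gaussianBinomial_mul_prod (hQ : 1 < Q) (a b : ℕ) :
    gaussianBinomial Q a b * ∏ i ∈ Finset.range b, ((Q : ℚ) ^ b - (Q : ℚ) ^ i) =
      ∏ i ∈ Finset.range b, ((Q : ℚ) ^ a - (Q : ℚ) ^ i) := by
  induction b generalizing a with
  | zero => simp [gaussianBinomial_zero_right]
  | succ b ih =>
    cases a with
    | zero =>
      rw [gaussianBinomial_eq_zero_of_lt b.succ_pos, zero_mul, Finset.prod_range_succ', pow_zero,
        sub_self, mul_zero]
    | succ a =>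
      have hden := natCast_pow_sub_one_ne_zero hQ b.add_one_ne_zero
      rw [prod_range_succ_pow_sub_pow, prod_range_succ_pow_sub_pow, ← ih a,
        gaussianBinomial_succ_succ]
      field_simp

end GaussianBinomial

section MoebiusDeletion

open Finset

variable {α β 𝕜 : Type*} [PartialOrder α] [LocallyFiniteOrder α] [DecidableEq α]
  [PartialOrder β] [LocallyFiniteOrder β] [DecidableEq β]

theorem mu_eq_of_sum_Icc [AddCommGroup 𝕜] [One 𝕜] {a : α} {f : α → 𝕜}
    (hf : ∀ b, a ≤ b → ∑ x ∈ Icc a b, f x = if a = b then 1 else 0) {b : α} (hab : a ≤ b) :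
    mu 𝕜 a b = f b := by
  induction hcard : #(Icc a b) using Nat.strong_induction_on generalizing b with
  | _ k ih =>
    have hsum := (sum_Icc_mu_right (𝕜 := 𝕜) a b).trans (hf b hab).symm
    have hIco : ∑ x ∈ Ico a b, mu 𝕜 a x = ∑ x ∈ Ico a b, f x := by
      refine sum_congr rfl fun x hx => ih _ ?_ (mem_Ico.1 hx).1 rfl
      obtain ⟨_, hxb⟩ := mem_Ico.1 hx
      exact hcard ▸ card_lt_card (Icc_ssubset_Icc_right hab le_rfl hxb)
    rw [Icc_eq_cons_Ico hab, sum_cons, sum_cons, hIco] at hsum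
    exact add_right_cancel hsum

variable [Ring 𝕜]

open Classical in
variable (𝕜) in
/-- The Möbius function `μ(a, b)` of the poset obtained from `β` by deleting the antichain `A`,
as a function on all of `β`; it then vanishes at the deleted elements `b`. -/
noncomputable def muDelete (A : Set β) (a b : β) : 𝕜 :=
  mu 𝕜 a b - ∑ x ∈ Icc a b with x ∈ A, mu 𝕜 a x * mu 𝕜 x b

theorem muDelete_eq_zero {A : Set β} (hA : IsAntichain (· ≤ ·) A) {a b : β} (hb : b ∈ A) :
    muDelete 𝕜 A a b = 0 := by
  classical
  rw [muDelete, sub_eq_zero]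
  by_cases hab : a ≤ b
  · have hfilter : {x ∈ Icc a b | x ∈ A} = {b} := by
      ext x
      simp only [mem_filter, mem_Icc, mem_singleton]
      exact ⟨fun hx => hA.eq hx.2 hb hx.1.2, by rintro rfl; exact ⟨⟨hab, le_rfl⟩, hb⟩⟩
    rw [hfilter, sum_singleton, mu_self, mul_one]
  · rw [apply_eq_zero_of_not_le hab, Icc_eq_empty hab, filter_empty, sum_empty]

theorem sum_Icc_muDelete {A : Set β} (a : β) {b : β} (hb : b ∉ A) :
    ∑ y ∈ Icc a b, muDelete 𝕜 A a y = if a = b then 1 else 0 := by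
  classical
  simp only [muDelete]
  have hswap : ∑ y ∈ Icc a b, ∑ x ∈ Icc a y with x ∈ A, mu 𝕜 a x * mu 𝕜 x y =
      ∑ x ∈ Icc a b with x ∈ A, ∑ y ∈ Icc x b, mu 𝕜 a x * mu 𝕜 x y := by
    refine sum_comm' fun y x => ?_
    simp only [mem_filter, mem_Icc]
    grind
  have hdeleted : ∀ x ∈ {x ∈ Icc a b | x ∈ A}, ∑ y ∈ Icc x b, mu 𝕜 a x * mu 𝕜 x y = 0 := by
    intro x hx
    have hxb : x ≠ b := by
      rintro rfl
      exact hb (mem_filter.1 hx).2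
    rw [← mul_sum, sum_Icc_mu_right, if_neg hxb, mul_zero]
  rw [sum_sub_distrib, sum_Icc_mu_right, hswap, sum_eq_zero hdeleted, sub_zero]

theorem muDelete_eq_zero_of_not_le (A : Set β) {a b : β} (hab : ¬ a ≤ b) :
    muDelete 𝕜 A a b = 0 := by
  rw [muDelete, apply_eq_zero_of_not_le hab, Icc_eq_empty hab, filter_empty, sum_empty, sub_zero]

theorem mu_eq_muDelete {A : Set β} (hA : IsAntichain (· ≤ ·) A) (f : α ↪o β)
    (hf : Set.range f = Aᶜ) (a b : α) : mu 𝕜 a b = muDelete 𝕜 A (f a) (f b) := by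
  by_cases hab : a ≤ b
  · refine mu_eq_of_sum_Icc (f := fun b => muDelete 𝕜 A (f a) (f b)) (fun b _ => ?_) hab
    have hb : f b ∉ A := hf.subset ⟨b, rfl⟩
    simp only [← f.injective.eq_iff (a := a), ← sum_Icc_muDelete (𝕜 := 𝕜) (f a) hb]
    refine sum_of_injOn f f.injective.injOn (fun x hx => ?_) (fun y hy hyf => ?_) fun _ _ => rfl
    · simpa using hx
    · refine muDelete_eq_zero hA (by_contra fun hyA => ?_)
      obtain ⟨x, rfl⟩ := hf.superset hyA
      exact hyf ⟨x, by simpa using hy, rfl⟩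
  · rw [apply_eq_zero_of_not_le hab, muDelete_eq_zero_of_not_le A (by rwa [f.le_iff_le])]

open Classical in
theorem muDelete_eq_sub_sum_mem [Fintype β] (A : Set β) (a b : β) :
    muDelete 𝕜 A a b = mu 𝕜 a b - ∑ x with x ∈ A, mu 𝕜 a x * mu 𝕜 x b := by
  rw [muDelete, sub_right_inj]
  refine sum_subset (fun x hx => by simpa using (mem_filter.1 hx).2) fun x hx hxab => ?_
  by_cases hax : a ≤ x
  · have hxb : ¬ x ≤ b := by simp_all
    rw [apply_eq_zero_of_not_le hxb, mul_zero]
  · rw [apply_eq_zero_of_not_le hax, zero_mul]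

open Classical in
theorem sum_mu_eq_sub_sum_mem [Fintype α] [Fintype β] {A : Set β} (hA : IsAntichain (· ≤ ·) A)
    (f : α ↪o β) (hf : Set.range f = Aᶜ) (a : α) (p : β → Prop) [DecidablePred p] :
    ∑ b with p (f b), mu 𝕜 a b =
      ∑ y with p y, mu 𝕜 (f a) y - ∑ x with x ∈ A, mu 𝕜 (f a) x * ∑ y with p y, mu 𝕜 x y := by
  have hextend : ∑ b with p (f b), mu 𝕜 a b = ∑ y with p y, muDelete 𝕜 A (f a) y := by
    refine sum_of_injOn f f.injective.injOn (fun b hb => ?_) (fun y hy hyf => ?_)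
      fun b _ => mu_eq_muDelete hA f hf a b
    · simpa using hb
    · refine muDelete_eq_zero hA (by_contra fun hyA => ?_)
      obtain ⟨b, rfl⟩ := hf.superset hyA
      exact hyf ⟨b, by simpa using hy, rfl⟩
  simp only [hextend, muDelete_eq_sub_sum_mem, sum_sub_distrib, mul_sum]
  rw [sum_comm]

end MoebiusDeletion

section SubspaceCounting

theorem natCard_eq_mul_of_natCard_fiber {α β : Type*} [Finite β] {f : α → β} {c : ℕ}
    [∀ b, Finite {a // f a = b}] (hf : ∀ b, Nat.card {a // f a = b} = c) :
    Nat.card α = Nat.card β * c := by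
  have := Fintype.ofFinite β
  rw [Nat.card_congr (Equiv.sigmaFiberEquiv f).symm, Nat.card_sigma, Nat.card_eq_fintype_card,
    Finset.sum_congr rfl fun b _ => hf b, Finset.sum_const, smul_eq_mul, Finset.card_univ]

variable {F V : Type*} [Field F] [AddCommGroup V] [Module F V]

theorem natCard_linearIndependent [Finite F] [Finite V] (k : ℕ) :
    (Nat.card {s : Fin k → V // LinearIndependent F s} : ℚ) =
      ∏ i ∈ Finset.range k, ((Nat.card F : ℚ) ^ finrank F V - (Nat.card F : ℚ) ^ i) := by
  have := Fintype.ofFinite F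
  rcases le_or_gt k (finrank F V) with hk | hk
  · rw [card_linearIndependent hk, Finset.prod_range, Nat.cast_prod, Nat.card_eq_fintype_card]
    refine Finset.prod_congr rfl fun i _ => ?_
    rw [Nat.cast_sub (Nat.pow_le_pow_right Fintype.card_pos (by lia)), Nat.cast_pow, Nat.cast_pow]
  · have : IsEmpty {s : Fin k → V // LinearIndependent F s} :=
      ⟨fun s => hk.not_ge (by simpa using s.2.fintype_card_le_finrank)⟩
    rw [Nat.card_of_isEmpty, Nat.cast_zero,
      Finset.prod_eq_zero (Finset.mem_range.2 hk) (sub_self _)]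

/-- The linearly independent `k`-tuples spanning a given `k`-dimensional subspace `W` are the
linearly independent `k`-tuples of `W`. -/
noncomputable def linearIndependentSpanEqEquiv [FiniteDimensional F V] {k : ℕ}
    {W : Submodule F V} (hW : finrank F W = k) :
    {s : {s : Fin k → V // LinearIndependent F s} // Submodule.span F (Set.range s.1) = W} ≃
      {t : Fin k → W // LinearIndependent F t} where
  toFun s := ⟨fun i => ⟨s.1.1 i, s.2.le (Submodule.subset_span ⟨i, rfl⟩)⟩,
    LinearIndependent.of_comp W.subtype s.1.2⟩
  invFun t := ⟨⟨fun i => t.1 i, t.2.map' W.subtype W.ker_subtype⟩,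
    Submodule.eq_of_le_of_finrank_eq
      (Submodule.span_le.2 (Set.range_subset_iff.2 fun i => (t.1 i).2))
      ((finrank_span_eq_card (t.2.map' W.subtype W.ker_subtype)).trans (by simp [hW]))⟩
  left_inv _ := rfl
  right_inv _ := rfl

theorem ncard_submodule_finrank_eq [Finite F] [Finite V] (k : ℕ) :
    ({W : Submodule F V | finrank F W = k}.ncard : ℚ) =
      gaussianBinomial (Nat.card F) (finrank F V) k := by
  have hQ : 1 < Nat.card F := Finite.one_lt_card
  let spanOf (s : {s : Fin k → V // LinearIndependent F s}) :
      {W : Submodule F V // finrank F W = k} :=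
    ⟨Submodule.span F (Set.range s.1), by simpa using finrank_span_eq_card s.2⟩
  have hcount := congrArg (Nat.cast : ℕ → ℚ) <|
    natCard_eq_mul_of_natCard_fiber (f := spanOf)
      (c := Nat.card {t : Fin k → Fin k → F // LinearIndependent F t}) fun W => by
        have hfiber := Nat.card_congr <| (Equiv.subtypeEquivRight fun s =>
          Subtype.ext_iff (a1 := spanOf s)).trans (linearIndependentSpanEqEquiv W.2)
        rw [hfiber, ← Nat.cast_inj (R := ℚ), natCard_linearIndependent,
          natCard_linearIndependent, W.2, finrank_fin_fun]
  rw [Nat.cast_mul, natCard_linearIndependent, natCard_linearIndependent, finrank_fin_fun,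
    ← gaussianBinomial_mul_prod hQ] at hcount
  refine (mul_right_cancel₀ (Finset.prod_ne_zero_iff.2 fun i hi => sub_ne_zero.2 ?_) hcount).symm
  exact (pow_lt_pow_right₀ (by exact_mod_cast hQ) (Finset.mem_range.1 hi)).ne'

theorem finrank_comap_mkQ [FiniteDimensional F V] (A : Submodule F V) (S : Submodule F (V ⧸ A)) :
    finrank F (S.comap A.mkQ) = finrank F A + finrank F S := by
  have h := LinearMap.finrank_range_add_finrank_ker (A.mkQ.domRestrict (S.comap A.mkQ))
  rw [LinearMap.range_domRestrict, Submodule.map_comap_eq_of_surjective A.mkQ_surjective,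
    LinearMap.ker_domRestrict, Submodule.ker_mkQ] at h
  rw [← h, add_comm,
    ← (Submodule.submoduleOfEquivOfLe (Submodule.le_comap_mkQ A S)).finrank_eq]
  rfl

theorem ncard_submodule_ge_finrank_eq [Finite F] [Finite V] (A : Submodule F V) (k : ℕ) :
    ({Y : Submodule F V | A ≤ Y ∧ finrank F Y = finrank F A + k}.ncard : ℚ) =
      gaussianBinomial (Nat.card F) (finrank F V - finrank F A) k := by
  have : Finite (V ⧸ A) := Quotient.finite _
  have himage : {Y : Submodule F V | A ≤ Y ∧ finrank F Y = finrank F A + k} =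
      Submodule.comap A.mkQ '' {S | finrank F S = k} := by
    ext Y
    constructor
    · rintro ⟨hAY, hY⟩
      have hcomap : (Y.map A.mkQ).comap A.mkQ = Y := by
        rw [Submodule.comap_map_mkQ, sup_eq_right.2 hAY]
      refine ⟨Y.map A.mkQ, ?_, hcomap⟩
      rw [← hcomap, finrank_comap_mkQ] at hY
      exact Nat.add_left_cancel hY
    · rintro ⟨S, rfl, rfl⟩
      exact ⟨Submodule.le_comap_mkQ A S, finrank_comap_mkQ A S⟩
  rw [himage, Set.ncard_image_of_injective _
    (Submodule.comap_injective_of_surjective A.mkQ_surjective), ncard_submodule_finrank_eq,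
    Submodule.finrank_quotient]

theorem ncard_submodule_between_finrank_eq [Finite F] [Finite V] {A B : Submodule F V}
    (h : A ≤ B) (k : ℕ) :
    ({Y : Submodule F V | (A ≤ Y ∧ Y ≤ B) ∧ finrank F Y = finrank F A + k}.ncard : ℚ) =
      gaussianBinomial (Nat.card F) (finrank F B - finrank F A) k := by
  have hA : finrank F (A.submoduleOf B) = finrank F A :=
    (Submodule.submoduleOfEquivOfLe h).finrank_eq
  have himage : {Y : Submodule F V | (A ≤ Y ∧ Y ≤ B) ∧ finrank F Y = finrank F A + k} =
      Submodule.map B.subtype ''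
        {S | A.submoduleOf B ≤ S ∧ finrank F S = finrank F (A.submoduleOf B) + k} := by
    ext Y
    constructor
    · rintro ⟨⟨hAY, hYB⟩, hY⟩
      have hmap : (Y.submoduleOf B).map B.subtype = Y := by
        rw [Submodule.submoduleOf, Submodule.map_comap_subtype, inf_eq_right.2 hYB]
      refine ⟨Y.submoduleOf B, ⟨Submodule.comap_mono hAY, ?_⟩, hmap⟩
      rw [hA, ← hY, (Submodule.submoduleOfEquivOfLe hYB).finrank_eq]
    · rintro ⟨S, ⟨hAS, hS⟩, rfl⟩
      refine ⟨⟨?_, Submodule.map_subtype_le B S⟩, ?_⟩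
      · rw [← inf_eq_right.2 h, ← Submodule.map_comap_subtype]
        exact Submodule.map_mono hAS
      · rw [Submodule.finrank_map_subtype_eq, hS, hA]
  rw [himage, Set.ncard_image_of_injective _ (Submodule.map_injective_of_injective
    B.subtype_injective), ncard_submodule_ge_finrank_eq, hA]

end SubspaceCounting

section SubspaceMoebius

open Finset

variable {F V : Type*} [Field F] [AddCommGroup V] [Module F V] [Finite F] [Finite V]
  [LocallyFiniteOrder (Submodule F V)] [DecidableEq (Submodule F V)]

theorem sum_Icc_submodule_neg_one_pow {A B : Submodule F V} (h : A ≤ B) :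
    ∑ Y ∈ Icc A B, (-1 : ℤ) ^ (finrank F Y - finrank F A) *
        (Nat.card F : ℤ) ^ (finrank F Y - finrank F A).choose 2 = if A = B then 1 else 0 := by
  have hAB : A = B ↔ finrank F B - finrank F A = 0 :=
    ⟨fun hAB => by rw [hAB, Nat.sub_self],
      fun hdim => Submodule.eq_of_le_of_finrank_le h (Nat.sub_eq_zero_iff_le.1 hdim)⟩
  have hcard (k : ℕ) : (#{Y ∈ Icc A B | finrank F (Y : Submodule F V) - finrank F A = k} : ℚ) =
      gaussianBinomial (Nat.card F) (finrank F B - finrank F A) k := by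
    rw [← ncard_submodule_between_finrank_eq h, ← Set.ncard_coe_finset]
    congr 2
    ext Y
    simp only [coe_filter, mem_Icc, Set.mem_ofPred_eq, and_congr_right_iff]
    intro hY
    have := Submodule.finrank_mono hY.1
    lia
  have hmaps : ∀ Y ∈ Icc A B,
      finrank F Y - finrank F A ∈ range (finrank F B - finrank F A + 1) := fun Y hY =>
    mem_range_succ_iff.2 (Nat.sub_le_sub_right (Submodule.finrank_mono (mem_Icc.1 hY).2) _)
  rw [← sum_fiberwise_of_maps_to hmaps, ← Int.cast_inj (α := ℚ)]
  simp only [hAB, Int.cast_ite, Int.cast_one, Int.cast_zero,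
    ← sum_neg_one_pow_mul_gaussianBinomial (Q := Nat.card F) Finite.one_lt_card, Int.cast_sum]
  refine sum_congr rfl fun k _ => ?_
  rw [← hcard, mul_comm, ← nsmul_eq_mul, ← sum_const]
  refine sum_congr rfl fun Y hY => ?_
  rw [(mem_filter.1 hY).2]
  push_cast
  rfl

theorem mu_submodule {A B : Submodule F V} (h : A ≤ B) :
    mu ℤ A B = (-1) ^ (finrank F B - finrank F A) *
      (Nat.card F : ℤ) ^ (finrank F B - finrank F A).choose 2 :=
  mu_eq_of_sum_Icc (f := fun Y : Submodule F V => (-1) ^ (finrank F Y - finrank F A) *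
    (Nat.card F : ℤ) ^ (finrank F Y - finrank F A).choose 2)
    (fun _ => sum_Icc_submodule_neg_one_pow) h

theorem sum_mu_submodule_finrank_eq [Fintype (Submodule F V)] (A : Submodule F V) (k : ℕ) :
    ((∑ Y with finrank F (Y : Submodule F V) = finrank F A + k, mu ℤ A Y : ℤ) : ℚ) =
      (-1) ^ k * (Nat.card F : ℚ) ^ k.choose 2 *
        gaussianBinomial (Nat.card F) (finrank F V - finrank F A) k := by
  classical
  have hmu : ∀ Y : Submodule F V, finrank F Y = finrank F A + k →
      mu ℤ A Y = if A ≤ Y then (-1) ^ k * (Nat.card F : ℤ) ^ k.choose 2 else 0 := by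
    intro Y hY
    split_ifs with h
    · rw [mu_submodule h, hY, Nat.add_sub_cancel_left]
    · exact apply_eq_zero_of_not_le h _
  have hcard : (#{Y : Submodule F V | finrank F Y = finrank F A + k ∧ A ≤ Y} : ℚ) =
      gaussianBinomial (Nat.card F) (finrank F V - finrank F A) k := by
    rw [← ncard_submodule_ge_finrank_eq, ← Set.ncard_coe_finset]
    simp only [coe_filter, mem_univ, true_and, and_comm]
  rw [sum_congr rfl fun Y hY => hmu Y (mem_filter.1 hY).2, ← sum_filter, filter_filter,
    sum_const, nsmul_eq_mul, ← hcard]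
  push_cast
  ring

end SubspaceMoebius

section FullRank

section Lines

variable {K L ι : Type*} [Field K] [Field L] [Algebra K L]

variable (K L ι) in
/-- The lines of `L^ι` spanned by a vector of maximal rank, that is, by a vector whose entries are
linearly independent over `K`. -/
def fullRankLines : Set (Submodule L (ι → L)) :=
  {X | ∃ v : ι → L, LinearIndependent K v ∧ Submodule.span L {v} = X}

theorem linearIndependent_smul_iff {c : L} (hc : c ≠ 0) {v : ι → L} :
    LinearIndependent K (c • v) ↔ LinearIndependent K v :=
  LinearMap.linearIndependent_iff (LinearMap.mulLeft K c)
    (LinearMap.ker_eq_bot.2 (mul_right_injective₀ hc)) (v := v)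

theorem le_span_dependent_of_notMem_fullRankLines {X : Submodule L (ι → L)}
    (hX : X ∉ fullRankLines K L ι) :
    X ≤ Submodule.span L {v ∈ X | ¬ LinearIndependent K v} := by
  set S := Submodule.span L {v ∈ X | ¬ LinearIndependent K v}
  intro v hv
  by_contra hvS
  have hmem : ∀ w ∈ X, w ∉ S → LinearIndependent K w := fun w hw hwS =>
    by_contra fun h => hwS (Submodule.subset_span ⟨hw, h⟩)
  have hvLI := hmem v hv hvS
  refine hX ⟨v, hvLI, le_antisymm ((Submodule.span_singleton_le_iff_mem _ _).2 hv) fun w hw => ?_⟩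
  have hv0 (i : ι) : v i ≠ 0 := hvLI.ne_zero i
  have hsub (i : ι) : w - (w i / v i) • v ∈ S := by
    by_contra h
    refine (hmem _ (X.sub_mem hw (X.smul_mem _ hv)) h).ne_zero i ?_
    rw [Pi.sub_apply, Pi.smul_apply, smul_eq_mul, div_mul_cancel₀ _ (hv0 i), sub_self]
  -- Otherwise a nonzero multiple of `v` would be a difference of two elements of `S`.
  have hratio (i j : ι) : w i / v i = w j / v j := by
    by_contra hne
    have h := S.sub_mem (hsub j) (hsub i)
    rw [sub_sub_sub_cancel_left, ← sub_smul] at h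
    exact hvS ((S.smul_mem_iff (sub_ne_zero.2 hne)).1 h)
  rcases isEmpty_or_nonempty ι with _ | ⟨⟨i⟩⟩
  · exact Subsingleton.elim 0 w ▸ Submodule.zero_mem _
  · refine Submodule.mem_span_singleton.2 ⟨w i / v i, funext fun j => ?_⟩
    rw [Pi.smul_apply, smul_eq_mul, hratio i j, div_mul_cancel₀ _ (hv0 j)]

theorem span_dependent_eq_bot_of_mem_fullRankLines {X : Submodule L (ι → L)}
    (hX : X ∈ fullRankLines K L ι) :
    Submodule.span L {v ∈ X | ¬ LinearIndependent K v} = ⊥ := by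
  obtain ⟨w, hw, rfl⟩ := hX
  rw [Submodule.span_eq_bot]
  rintro v ⟨hv, hvLI⟩
  obtain ⟨c, rfl⟩ := Submodule.mem_span_singleton.1 hv
  rcases eq_or_ne c 0 with rfl | hc
  · exact zero_smul L w
  · exact absurd ((linearIndependent_smul_iff hc).2 hw) hvLI

variable [Nonempty ι]

theorem ne_zero_of_linearIndependent_entries {v : ι → L} (hv : LinearIndependent K v) : v ≠ 0 :=
  fun h => hv.ne_zero (Classical.arbitrary ι) (congrFun h _)

theorem finrank_eq_one_of_mem_fullRankLines {X : Submodule L (ι → L)}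
    (hX : X ∈ fullRankLines K L ι) : finrank L X = 1 := by
  obtain ⟨v, hv, rfl⟩ := hX
  exact finrank_span_singleton (ne_zero_of_linearIndependent_entries hv)

theorem span_dependent_eq_iff_notMem_fullRankLines {X : Submodule L (ι → L)} :
    Submodule.span L {v ∈ X | ¬ LinearIndependent K v} = X ↔ X ∉ fullRankLines K L ι := by
  refine ⟨fun hspan hX => ?_, fun hX => le_antisymm (Submodule.span_le.2 fun v hv => hv.1)
    (le_span_dependent_of_notMem_fullRankLines hX)⟩
  have hdim := finrank_eq_one_of_mem_fullRankLines hX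
  rw [← hspan, span_dependent_eq_bot_of_mem_fullRankLines hX, finrank_bot] at hdim
  exact zero_ne_one hdim

theorem isAntichain_fullRankLines [Finite ι] : IsAntichain (· ≤ ·) (fullRankLines K L ι) :=
  fun _ hX _ hY hne hXY => hne <| Submodule.eq_of_le_of_finrank_eq hXY <|
    (finrank_eq_one_of_mem_fullRankLines hX).trans (finrank_eq_one_of_mem_fullRankLines hY).symm

theorem natCard_linearIndependent_eq_ncard_fullRankLines_mul [Finite L] [Finite ι] :
    Nat.card {v : ι → L // LinearIndependent K v} =
      (fullRankLines K L ι).ncard * (Nat.card L - 1) := by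
  rw [← Nat.card_coe_set_eq, ← Nat.card_units]
  refine natCard_eq_mul_of_natCard_fiber
    (f := fun v => (⟨Submodule.span L {v.1}, v.1, v.2, rfl⟩ : fullRankLines K L ι)) ?_
  rintro ⟨_, w, hw, rfl⟩
  refine (Nat.card_eq_of_bijective
    (fun c : Lˣ => ⟨⟨(c : L) • w, (linearIndependent_smul_iff c.ne_zero).2 hw⟩,
      Subtype.ext (Submodule.span_singleton_group_smul_eq L c w)⟩) ⟨fun c d hcd => ?_, ?_⟩).symm
  · have hcd' : (c : L) • w = (d : L) • w := congrArg (fun v => v.1.1) hcd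
    exact Units.ext (smul_left_injective L (ne_zero_of_linearIndependent_entries hw) hcd')
  · rintro ⟨⟨v, hv⟩, hspan⟩
    obtain ⟨c, rfl⟩ := Submodule.span_singleton_eq_span_singleton.1
      (congrArg Subtype.val hspan).symm
    exact ⟨c, rfl⟩

end Lines

variable {K L : Type*} [Field K] [Field L] [Algebra K L] {i n : ℕ}

theorem vectorRank_zero : vectorRank K (0 : Fin n → L) = 0 := by
  rw [vectorRank, Submodule.span_eq_bot.2 (by rintro _ ⟨_, rfl⟩; rfl), finrank_bot]

theorem exists_span_range_eq_iff {X : Submodule L (Fin n → L)} :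
    (∃ ℓ : ℕ, 1 ≤ ℓ ∧ ∃ v : Fin ℓ → Fin n → L,
      (∀ k, vectorRank K (v k) ≤ i) ∧ X = Submodule.span L (Set.range v)) ↔
      Submodule.span L {v ∈ X | vectorRank K v ≤ i} = X := by
  constructor
  · rintro ⟨ℓ, -, v, hv, rfl⟩
    exact le_antisymm (Submodule.span_le.2 fun v hv => hv.1) <| Submodule.span_mono <|
      Set.range_subset_iff.2 fun k => ⟨Submodule.subset_span ⟨k, rfl⟩, hv k⟩
  · intro hX
    obtain ⟨t, htX, ht⟩ := (Submodule.fg_span_iff_fg_span_finset_subset _).1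
      (IsNoetherian.noetherian (Submodule.span L {v ∈ X | vectorRank K v ≤ i}))
    refine ⟨t.card + 1, Nat.succ_pos _, Fin.cons 0 (Subtype.val ∘ t.equivFin.symm), ?_, ?_⟩
    · exact Fin.cases (vectorRank_zero.trans_le i.zero_le) fun k => (htX (t.equivFin.symm k).2).2
    · rw [Fin.range_cons, Submodule.span_insert_zero, EquivLike.range_comp, Subtype.range_coe,
        ← hX, ht]

variable [NeZero n]

theorem vectorRank_le_sub_one_iff {v : Fin n → L} :
    vectorRank K v ≤ n - 1 ↔ ¬ LinearIndependent K v := by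
  rw [linearIndependent_iff_card_le_finrank_span, Fintype.card_fin, Set.finrank, vectorRank]
  have := NeZero.pos n
  lia

theorem ncard_fullRankLines [Finite L] :
    ((fullRankLines K L (Fin n)).ncard : ℚ) =
      ∏ s ∈ Finset.Icc 1 (n - 1), ((Nat.card K : ℚ) ^ finrank K L - (Nat.card K : ℚ) ^ s) := by
  have : Finite K := Finite.of_injective _ (algebraMap K L).injective
  have hcount := congrArg (Nat.cast : ℕ → ℚ) <|
    natCard_linearIndependent_eq_ncard_fullRankLines_mul (K := K) (L := L) (ι := Fin n)
  have hne : (Nat.card K : ℚ) ^ finrank K L - 1 ≠ 0 :=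
    natCast_pow_sub_one_ne_zero Finite.one_lt_card finrank_pos.ne'
  rw [natCard_linearIndependent, Finset.range_eq_Ico,
    Finset.prod_eq_prod_Ico_succ_bot (NeZero.pos n), pow_zero, Nat.cast_mul,
    Nat.cast_pred Nat.card_pos, natCard_eq_pow_finrank (K := K) (V := L), Nat.cast_pow,
    mul_comm] at hcount
  rw [← mul_right_cancel₀ hne hcount, zero_add,
    ← Finset.Ico_add_one_right_eq_Icc, Nat.sub_add_cancel NeZero.one_le]

end FullRank

section Whitney

section GradedPoset

variable {P : Type*} [PartialOrder P] [OrderBot P] [GradeMinOrder ℕ P]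

theorem grade_eq_zero_iff {s : P} : grade ℕ s = 0 ↔ s = ⊥ := by
  refine ⟨fun hs => by_contra fun hne => ?_, fun hs => hs ▸ grade_bot⟩
  exact Nat.not_lt_zero _ (hs ▸ grade_strictMono (𝕆 := ℕ) (bot_lt_iff_ne_bot.2 hne))

variable [Fintype P]

theorem whitneyFirst_zero [LocallyFiniteOrder P] : whitneyFirst P 0 = 1 := by
  classical
  have hbot : ({s | grade ℕ s = 0} : Finset P) = {⊥} := by
    ext s
    rw [Finset.mem_filter_univ, Finset.mem_singleton, grade_eq_zero_iff]
  rw [whitneyFirst, hbot, Finset.sum_singleton, mu_self]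

theorem whitneySecond_zero : whitneySecond P 0 = 1 := by
  simp only [whitneySecond, grade_eq_zero_iff, Nat.card_unique]

end GradedPoset

namespace RankMetricLattice

variable {K L : Type*} [Field K] [Field L] [Algebra K L] {i n : ℕ}

/-- The inclusion of the rank-metric lattice into the lattice of all `L`-subspaces of `Lⁿ`. -/
def toSubmodule : RankMetricLattice K L i n ↪o Submodule L (Fin n → L) :=
  OrderEmbedding.subtype _

variable [NeZero n]

theorem range_toSubmodule :
    Set.range (toSubmodule (K := K) (L := L) (i := n - 1) (n := n)) =
      (fullRankLines K L (Fin n))ᶜ := by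
  ext X
  simp only [Set.mem_compl_iff, ← span_dependent_eq_iff_notMem_fullRankLines,
    ← vectorRank_le_sub_one_iff, ← exists_span_range_eq_iff]
  exact ⟨fun ⟨Y, hY⟩ => hY ▸ Y.2, fun hX => ⟨⟨X, hX⟩, rfl⟩⟩

variable [Finite L]

theorem whitneyFirst_succ (k : ℕ) :
    (whitneyFirst (RankMetricLattice K L (n - 1) n) (k + 1) : ℚ) =
      (-1) ^ (k + 1) * ((Nat.card L : ℚ) ^ (k + 1).choose 2 *
          gaussianBinomial (Nat.card L) n (k + 1) -
        (Nat.card L : ℚ) ^ k.choose 2 * gaussianBinomial (Nat.card L) (n - 1) k *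
          (fullRankLines K L (Fin n)).ncard) := by
  classical
  have := Fintype.ofFinite (Submodule L (Fin n → L))
  let : LocallyFiniteOrder (Submodule L (Fin n → L)) := Fintype.toLocallyFiniteOrder
  have hdelete : whitneyFirst (RankMetricLattice K L (n - 1) n) (k + 1) =
      ∑ Y with finrank L (Y : Submodule L (Fin n → L)) = k + 1, mu ℤ ⊥ Y -
        ∑ X with X ∈ fullRankLines K L (Fin n),
          mu ℤ ⊥ X * ∑ Y with finrank L (Y : Submodule L (Fin n → L)) = k + 1, mu ℤ X Y :=
    sum_mu_eq_sub_sum_mem isAntichain_fullRankLines toSubmodule range_toSubmodule ⊥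
      fun Y => finrank L Y = k + 1
  have hbot := sum_mu_submodule_finrank_eq (⊥ : Submodule L (Fin n → L)) (k + 1)
  have hline : ∀ X ∈ fullRankLines K L (Fin n), ((mu ℤ ⊥ X *
      ∑ Y with finrank L (Y : Submodule L (Fin n → L)) = k + 1, mu ℤ X Y : ℤ) : ℚ) =
        (-1) ^ (k + 1) * (Nat.card L : ℚ) ^ k.choose 2 *
          gaussianBinomial (Nat.card L) (n - 1) k := by
    intro X hX
    have hdim := finrank_eq_one_of_mem_fullRankLines hX
    have hmu : mu ℤ ⊥ X = -1 := by simp [mu_submodule bot_le, hdim]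
    have hsum := sum_mu_submodule_finrank_eq X k
    rw [hdim, finrank_fin_fun, add_comm] at hsum
    rw [Int.cast_mul, hsum, hmu, Int.cast_neg, Int.cast_one]
    ring
  rw [finrank_bot, zero_add, finrank_fin_fun, Nat.sub_zero] at hbot
  rw [hdelete, Int.cast_sub, hbot, Int.cast_sum,
    Finset.sum_congr rfl fun X hX => hline X (Finset.mem_filter.1 hX).2, Finset.sum_const,
    nsmul_eq_mul, ← Set.ncard_coe_finset, Finset.coe_filter_univ, Set.ofPred_mem_eq]
  ring

theorem whitneySecond_eq_ncard (j : ℕ) :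
    whitneySecond (RankMetricLattice K L (n - 1) n) j =
      ({X : Submodule L (Fin n → L) | finrank L X = j} \ fullRankLines K L (Fin n)).ncard := by
  rw [Set.sdiff_eq, ← range_toSubmodule, ← Set.image_preimage_eq_inter_range,
    Set.ncard_image_of_injective _ toSubmodule.injective]
  rfl

theorem whitneySecond_one :
    (whitneySecond (RankMetricLattice K L (n - 1) n) 1 : ℚ) =
      gaussianBinomial (Nat.card L) n 1 - (fullRankLines K L (Fin n)).ncard := by
  have hsub : fullRankLines K L (Fin n) ⊆ {X | finrank L X = 1} :=
    fun _ => finrank_eq_one_of_mem_fullRankLines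
  rw [whitneySecond_eq_ncard, Set.cast_ncard_sdiff hsub (Set.toFinite _),
    ncard_submodule_finrank_eq, finrank_fin_fun]

theorem whitneySecond_of_two_le {j : ℕ} (hj : 2 ≤ j) :
    (whitneySecond (RankMetricLattice K L (n - 1) n) j : ℚ) =
      gaussianBinomial (Nat.card L) n j := by
  have hdisjoint : Disjoint {X : Submodule L (Fin n → L) | finrank L X = j}
      (fullRankLines K L (Fin n)) :=
    Set.disjoint_left.2 fun X hX hline =>
      absurd (finrank_eq_one_of_mem_fullRankLines hline) (by grind)
  rw [whitneySecond_eq_ncard, hdisjoint.sdiff_eq_left, ncard_submodule_finrank_eq,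
    finrank_fin_fun]

end RankMetricLattice

end Whitney

open RankMetricLattice in
theorem mainTheorem9_general {K L : Type*} [Field K] [Field L] [Algebra K L] [Finite L]
    (q n m : ℕ) (hq : Nat.card K = q) (hm : finrank K L = m) (hn : 1 ≤ n) :
    whitneyFirst (RankMetricLattice K L (n - 1) n) 0 = 1 ∧
    (∀ j : ℕ, 1 ≤ j →
      (whitneyFirst (RankMetricLattice K L (n - 1) n) j : ℚ) =
        (-1) ^ j * ((q : ℚ) ^ (m * j.choose 2) * gaussianBinomial (q ^ m) n j -
          (q : ℚ) ^ (m * (j - 1).choose 2) * gaussianBinomial (q ^ m) (n - 1) (j - 1) *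
            ∏ s ∈ Finset.Icc 1 (n - 1), ((q : ℚ) ^ m - (q : ℚ) ^ s))) ∧
    whitneySecond (RankMetricLattice K L (n - 1) n) 0 = 1 ∧
    (whitneySecond (RankMetricLattice K L (n - 1) n) 1 : ℚ) =
      gaussianBinomial (q ^ m) n 1 -
        ∏ s ∈ Finset.Icc 1 (n - 1), ((q : ℚ) ^ m - (q : ℚ) ^ s) ∧
    (∀ j : ℕ, 2 ≤ j →
      (whitneySecond (RankMetricLattice K L (n - 1) n) j : ℚ) = gaussianBinomial (q ^ m) n j) := by
  have : NeZero n := .of_pos hn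
  have hL : Nat.card L = q ^ m := hq ▸ hm ▸ natCard_eq_pow_finrank
  rw [← hL, ← hq, ← hm, ← ncard_fullRankLines]
  refine ⟨whitneyFirst_zero, fun j hj => ?_, whitneySecond_zero, whitneySecond_one,
    fun j => whitneySecond_of_two_le⟩
  obtain ⟨k, rfl⟩ := Nat.exists_eq_add_of_le' hj
  rw [pow_mul, pow_mul, hm, hq, ← Nat.cast_pow, ← hL, Nat.add_sub_cancel, whitneyFirst_succ]

theorem mainTheorem9 {K L : Type*} [Field K] [Field L] [Algebra K L] [Finite K] [Finite L]
    (q n m : ℕ) (hq : Nat.card K = q) (hm : Module.finrank K L = m)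
    (hn : 2 ≤ n) (hnm : n ≤ m) :
    whitneyFirst (RankMetricLattice K L (n - 1) n) 0 = 1 ∧
    (∀ j : ℕ, 1 ≤ j → j ≤ n →
      (whitneyFirst (RankMetricLattice K L (n - 1) n) j : ℚ) =
        (-1) ^ j * ((q : ℚ) ^ (m * j.choose 2) * gaussianBinomial (q ^ m) n j -
          (q : ℚ) ^ (m * (j - 1).choose 2) * gaussianBinomial (q ^ m) (n - 1) (j - 1) *
            ∏ s ∈ Finset.Icc 1 (n - 1), ((q : ℚ) ^ m - (q : ℚ) ^ s))) ∧
    whitneySecond (RankMetricLattice K L (n - 1) n) 0 = 1 ∧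
    (whitneySecond (RankMetricLattice K L (n - 1) n) 1 : ℚ) =
      gaussianBinomial (q ^ m) n 1 -
        ∏ s ∈ Finset.Icc 1 (n - 1), ((q : ℚ) ^ m - (q : ℚ) ^ s) ∧
    (∀ j : ℕ, 2 ≤ j → j ≤ n →
      (whitneySecond (RankMetricLattice K L (n - 1) n) j : ℚ) =
        gaussianBinomial (q ^ m) n j) := by
  obtain ⟨hw₀, hw, hW₀, hW₁, hW⟩ := mainTheorem9_general q n m hq hm (one_le_two.trans hn)
  exact ⟨hw₀, fun j hj _ => hw j hj, hW₀, hW₁, fun j hj _ => hW j hj⟩
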